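/- Let $\mathcal X$ be a finite set, $\mathcal H_E$ a finite-dimensional Hilbert space, and $\rho_{XE}=\sum_{x\in\mathcal X}p_X(x)\,|x\rangle\langle x|\otimes\rho_E^x$ a classical-quantum state, where $p_X$ is a probability distribution on $\mathcal X$ and each $\rho_E^x$ is a density operator on $\mathcal H_E$. Put $\rho_E=\sum_x p_X(x)\rho_E^x$. For $\beta\in(0,1)$ let $$H^{\downarrow}_{\beta}(X|E)_\rho=-\frac{1}{\beta-1}\log\operatorname{Tr}\left[\rho_{XE}^{\beta}\,(\mathbb 1_X\otimes\rho_E)^{1-\beta}\right],\qquad H(X|E)_\rho=-\operatorname{Tr}\left[\rho_{XE}\left(\log\rho_{XE}-\log(\mathbb 1_X\otimes\rho_E)\right)\right],$$ with natural logarithms taken on supports. For an integer $n\ge 1$ and a finite set $\mathcal Z_n$, a random function $h:\mathcal X^n\to\mathcal Z_n$ is called strongly $2$-universal if $\Pr_h\{h(x)=z\wedge h(x')=z'\}=|\mathcal Z_n|^{-2}$ for all $x\neq x'$ in $\mathcal X^n$ and all $z,z'\in\mathcal Z_n$. For such $h$ let $$\varepsilon_n(h)=\frac12\,\mathbb E_h\left\|\mathcal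 R^{h}(\rho_{XE}^{\otimes n})-\mathcal U^n(\rho_{XE}^{\otimes n})\right\|_1 ,$$ where, for an operator $\theta$ on $\mathbb C^{\mathcal X^n}\otimes\mathcal H_E^{\otimes n}$ with blocks $\theta_x=\langle x|\theta|x\rangle$, $\mathcal R^h(\theta)=\sum_{x\in\mathcal X^n}|h(x)\rangle\langle h(x)|\otimes\theta_x$, $\mathcal U^n(\theta)=\frac{\mathbb 1_{\mathcal Z_n}}{|\mathcal Z_n|}\otimes\sum_{x\in\mathcal X^n}\theta_x$, and $\|A\|_1=\operatorname{Tr}\sqrt{A^\dagger A}$. Then the following hold. 1. For every $n\ge1$, every finite set $\mathcal Z_n$, every strongly $2$-universal random function $h:\mathcal X^n\to\mathcal Z_n$ and every $\alpha\in(1/2,1)$, with $R=\frac1n\log|\mathcal Z_n|$, $$\varepsilon_n(h)\;\ge\;1-4\exp\left(-n\,\frac{1-\alpha}{\alpha}\left(R-H^{\downarrow}_{2-1/\alpha}(X|E)_\rho\right)\right).$$ 2. For every real $R>H(X|E)_\rho$ there is a constant $c>0$, depending only on $\rho_{XE}$ and $R$, such that for every $n\ge1$, every finite set $\mathcal Z_n$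 with $\frac1n\log|\mathcal Z_n|\ge R$ and every strongly $2$-universal random function $h:\mathcal X^n\to\mathcal Z_n$, $$1-4e^{-cn}\;\le\;\varepsilon_n(h)\;\le\;1 .$$ -/

import Mathlib

namespace PrivacyAmplification

open scoped Kronecker ComplexOrder

/-- A classical-quantum state `∑ x, p x |x⟩⟨x| ⊗ ρ x` with finite alphabet `X` and quantum system
`ℂ^E`: a probability distribution `p` on `X` and a density matrix `ρ x` for each letter `x`. -/
structure CQState (X E : Type*) [Fintype X] [Fintype E] where
  /-- the distribution of the letter -/
  p : X → ℝ
  /-- the conditional state of the quantum system -/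
  ρ : X → Matrix E E ℂ
  p_nonneg : ∀ x, 0 ≤ p x
  p_sum : ∑ x, p x = 1
  ρ_posSemidef : ∀ x, (ρ x).PosSemidef
  ρ_trace : ∀ x, (ρ x).trace = 1

/-- The joint density matrix `ρ_XE = ∑ x, p x |x⟩⟨x| ⊗ ρ x` on `ℂ^X ⊗ ℂ^E`. -/
noncomputable def CQState.joint {X E : Type*} [Fintype X] [DecidableEq X] [Fintype E]
    (s : CQState X E) : Matrix (X × E) (X × E) ℂ :=
  ∑ x, (s.p x : ℂ) • (Matrix.single x x (1 : ℂ) ⊗ₖ s.ρ x)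

/-- The block `⟨x| θ |x⟩` of an operator `θ` on `ℂ^X ⊗ ℂ^E`, an operator on `ℂ^E`. -/
def block {X E : Type*} (θ : Matrix (X × E) (X × E) ℂ) (x : X) : Matrix E E ℂ :=
  Matrix.of fun e e' => θ (x, e) (x, e')

/-- The partial trace over the first system, `Tr_X θ = ∑ x, ⟨x| θ |x⟩`. -/
def traceLeft {X E : Type*} [Fintype X] (θ : Matrix (X × E) (X × E) ℂ) : Matrix E E ℂ :=
  ∑ x, block θ x

/-- The `n`-fold tensor power `θ^{⊗n}` of an operator on `ℂ^X ⊗ ℂ^E`, with the tensor factors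
sorted so that it acts on `ℂ^(X^n) ⊗ ℂ^(E^n)`. -/
def tensorPow {X E : Type*} (n : ℕ) (θ : Matrix (X × E) (X × E) ℂ) :
    Matrix ((Fin n → X) × (Fin n → E)) ((Fin n → X) × (Fin n → E)) ℂ :=
  Matrix.of fun a b => ∏ i, θ (a.1 i, a.2 i) (b.1 i, b.2 i)

/-- The trace norm `‖A‖₁ = Tr √(Aᴴ A)`. -/
noncomputable def traceNorm {m : Type*} [Fintype m] [DecidableEq m] (A : Matrix m m ℂ) : ℝ :=
  (cfc Real.sqrt (A.conjTranspose * A)).trace.re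

/-- The Petz-Rényi divergence `D_α(ρ‖σ) = (α - 1)⁻¹ log Tr[ρ^α σ^(1-α)]`, for positive
semidefinite `ρ`, `σ` with `supp ρ ⊆ supp σ`; powers are taken on the support. -/
noncomputable def petzDiv {m : Type*} [Fintype m] [DecidableEq m] (α : ℝ) (ρ σ : Matrix m m ℂ) :
    ℝ :=
  1 / (α - 1) *
    Real.log (cfc (fun t : ℝ => t ^ α) ρ * cfc (fun t : ℝ => t ^ (1 - α)) σ).trace.re

/-- The quantum relative entropy `D(ρ‖σ) = Tr[ρ (log ρ - log σ)]`, for positive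
semidefinite `ρ`, `σ` with `supp ρ ⊆ supp σ`; logarithms are taken on the support. -/
noncomputable def relEntropy {m : Type*} [Fintype m] [DecidableEq m] (ρ σ : Matrix m m ℂ) : ℝ :=
  (ρ * (cfc Real.log ρ - cfc Real.log σ)).trace.re

/-- The Petz-type conditional Rényi entropy `H↓_α(X|E) = -D_α(ρ_XE ‖ 1_X ⊗ ρ_E)`. -/
noncomputable def condRenyi {X E : Type*} [Fintype X] [DecidableEq X] [Fintype E] [DecidableEq E]
    (α : ℝ) (θ : Matrix (X × E) (X × E) ℂ) : ℝ :=
  -petzDiv α θ ((1 : Matrix X X ℂ) ⊗ₖ traceLeft θ)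

/-- The conditional entropy `H(X|E) = -D(ρ_XE ‖ 1_X ⊗ ρ_E)`. -/
noncomputable def condEntropy {X E : Type*} [Fintype X] [DecidableEq X] [Fintype E]
    [DecidableEq E] (θ : Matrix (X × E) (X × E) ℂ) : ℝ :=
  -relEntropy θ ((1 : Matrix X X ℂ) ⊗ₖ traceLeft θ)

/-- The map `R^h` that applies `h` to the first system: `∑ x, |h x⟩⟨h x| ⊗ ⟨x| θ |x⟩`. -/
def hashMap {X Z E : Type*} [Fintype X] [DecidableEq Z] (h : X → Z)
    (θ : Matrix (X × E) (X × E) ℂ) : Matrix (Z × E) (Z × E) ℂ :=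
  ∑ x, Matrix.single (h x) (h x) (1 : ℂ) ⊗ₖ block θ x

/-- The perfectly randomizing channel `U` from `X` to `Z`: `(1_Z / |Z|) ⊗ ∑ x, ⟨x| θ |x⟩`. -/
noncomputable def randomizingMap {X E : Type*} (Z : Type*) [Fintype X] [Fintype Z] [DecidableEq Z]
    (θ : Matrix (X × E) (X × E) ℂ) : Matrix (Z × E) (Z × E) ℂ :=
  ((Fintype.card Z : ℂ)⁻¹ • (1 : Matrix Z Z ℂ)) ⊗ₖ traceLeft θ

/-- A random hash function `X → Z`, given by its law `q` on the functions from `X` to `Z`, is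
strongly 2-universal if `Pr {h x = z ∧ h x' = z'} = 1 / |Z|²` whenever `x ≠ x'`. -/
def StronglyTwoUniversal {X Z : Type*} [Fintype Z] (q : PMF (X → Z)) : Prop :=
  ∀ x x' : X, x ≠ x' → ∀ z z' : Z,
    q.toOuterMeasure {h | h x = z ∧ h x' = z'} = 1 / (Fintype.card Z : ENNReal) ^ 2

/-- The expected trace distance `½ 𝔼_h ‖(R^h - U) θ‖₁`, for `h` distributed according to `q`. -/
noncomputable def expTraceDist {X Z E : Type*} [Fintype X] [DecidableEq X] [Fintype Z]
    [DecidableEq Z] [Fintype E] [DecidableEq E] (q : PMF (X → Z))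
    (θ : Matrix (X × E) (X × E) ℂ) : ℝ :=
  1 / 2 * ∑ h : X → Z, (q h).toReal * traceNorm (hashMap h θ - randomizingMap Z θ)

end PrivacyAmplification

/-! Hashing onto too many values leaves the outputs distinguishable from uniform. Write `θ_x` for
the blocks of the state, `σ` for their sum and `M = |Z|`. The two states being compared have equal
trace, so half their trace distance dominates the bias of any test between them. On output `z` the
test must separate `A = ∑_{h x = z} θ_x` from `B = σ / M`. Comparison with a pretty good measurement
bounds the best bias from below by `∑ (4 Tr[P_x θ_x] - 2 Tr[P_x (A + B)] - Tr θ_x)` for arbitrary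
effects `P_x` (`exists_test_sum_le`).

This bound is affine in `A`, and the `P_x` do not depend on `h`, so averaging over `h` needs only
the collision probability `1 / M`. The result is `∑ (Tr θ_x - 2 (Tr θ_x - Tr[P_x θ_x] + Tr[P_x
2σ/M]))`. The inner bracket is the error of testing `θ_x` against `2σ/M`. The quantum Chernoff bound
makes it at most `2 M^{-(1-β)} Tr[θ_x^β σ^{1-β}]`, giving the one-shot bound
`one_sub_le_expTraceDist`.

For tensor powers the sum of `Tr[θ_x^β σ^{1-β}]` is the `n`-th power of the single-copy
quasi-entropy, which yields the first claim with `β = 2 - 1/α`. For the second, the quasi-entropy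
equals `1` at `β = 1` with derivative `-H(X|E)`, so a rate above `H(X|E)` exceeds some Rényi entropy
of order `β < 1`. -/

namespace PrivacyAmplification

set_option linter.unusedSectionVars false

open scoped Kronecker ComplexOrder MatrixOrder Matrix.Norms.L2Operator

/-! ### Positive parts, the trace norm, and the quantum Chernoff bound. -/

section Effects

variable {m : Type*} [Fintype m] [DecidableEq m]

/-- Every function is continuous on the spectrum of a matrix. -/
lemma continuousOn_spectrum (A : Matrix m m ℂ) (f : ℝ → ℝ) : ContinuousOn f (spectrum ℝ A) :=
  (Matrix.finite_real_spectrum (A := A)).continuousOn f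

lemma trace_re_nonneg {A : Matrix m m ℂ} (hA : 0 ≤ A) : 0 ≤ A.trace.re :=
  (Complex.nonneg_iff.mp (Matrix.nonneg_iff_posSemidef.mp hA).trace_nonneg).1

lemma trace_mul_nonneg {A B : Matrix m m ℂ} (hA : 0 ≤ A) (hB : 0 ≤ B) :
    0 ≤ (A * B).trace.re := by
  obtain ⟨C, rfl⟩ := CStarAlgebra.nonneg_iff_eq_star_mul_self.mp hA
  rw [Matrix.mul_assoc, Matrix.trace_mul_comm]
  exact trace_re_nonneg (by simpa using star_left_conjugate_nonneg hB (star C))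

/-- For Hermitian factors, conjugating `Tr[A B]` gives `Tr[B A]`. Realness later lets the real part
pass through a product of traces. -/
lemma re_trace_mul_eq {A B : Matrix m m ℂ} (hA : 0 ≤ A) (hB : 0 ≤ B) :
    ((A * B).trace.re : ℂ) = (A * B).trace := by
  have hA' : A.conjTranspose = A := hA.isSelfAdjoint
  have hB' : B.conjTranspose = B := hB.isSelfAdjoint
  refine Complex.conj_eq_iff_re.mp ?_
  rw [starRingEnd_apply, ← Matrix.trace_conjTranspose, Matrix.conjTranspose_mul, hA', hB',
    Matrix.trace_mul_comm]

lemma trace_mul_le_trace_mul {A B C : Matrix m m ℂ} (hC : 0 ≤ C) (h : A ≤ B) :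
    (C * A).trace.re ≤ (C * B).trace.re := by
  have := trace_mul_nonneg hC (sub_nonneg.mpr h)
  rw [Matrix.mul_sub, Matrix.trace_sub, Complex.sub_re] at this
  linarith

lemma trace_mul_le_trace {A P : Matrix m m ℂ} (hA : 0 ≤ A) (h : P ≤ 1) :
    (P * A).trace.re ≤ A.trace.re := by
  rw [Matrix.trace_mul_comm]
  simpa using trace_mul_le_trace_mul hA h

/-- The positive part `Q` of a Hermitian matrix `Y`, and the projection `P` onto its range. -/
lemma exists_positivePart {Y : Matrix m m ℂ} (hY : IsSelfAdjoint Y) :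
    ∃ P Q : Matrix m m ℂ, 0 ≤ P ∧ P ≤ 1 ∧ 0 ≤ Q ∧ Y ≤ Q ∧ P * Y = Q ∧
      traceNorm Y = 2 * Q.trace.re - Y.trace.re := by
  have hc := continuousOn_spectrum Y
  refine ⟨cfc (fun t : ℝ => if 0 < t then (1 : ℝ) else 0) Y, cfc (fun t : ℝ => max t 0) Y,
    cfc_nonneg fun x _ => by positivity, ?_, cfc_nonneg fun x _ => le_max_right _ _, ?_, ?_, ?_⟩
  · exact cfc_le_one _ _ fun x _ => by split_ifs <;> norm_num
  · conv_lhs => rw [← cfc_id ℝ Y]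
    exact cfc_mono (fun x _ => le_max_left _ _) (hc _) (hc _)
  · conv_lhs =>
      enter [2]
      rw [← cfc_id ℝ Y]
    rw [← cfc_mul _ _ Y (hc _) (hc _)]
    refine cfc_congr fun x _ => ?_
    by_cases h : 0 < x
    · simp [h, h.le]
    · simp [h, not_lt.mp h]
  · have h1 : Y.conjTranspose * Y = cfc (fun t : ℝ => t * t) Y := by
      have h0 : Y.conjTranspose = Y := hY
      rw [h0]
      conv_lhs => rw [← cfc_id ℝ Y]
      rw [← cfc_mul _ _ Y (hc _) (hc _)]
      rfl
    have h2 : cfc Real.sqrt (Y.conjTranspose * Y) = (2 : ℝ) • cfc (fun t : ℝ => max t 0) Y - Y := by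
      rw [h1, ← cfc_comp' Real.sqrt (fun t : ℝ => t * t) Y
        ((Matrix.finite_real_spectrum.image _).continuousOn _) (hc _)]
      conv_rhs =>
        enter [2]
        rw [← cfc_id ℝ Y]
      rw [← cfc_smul (2 : ℝ) _ Y (hc _), ← cfc_sub _ _ Y (hc _) (hc _)]
      refine cfc_congr fun x _ => ?_
      simp only [Real.sqrt_mul_self_eq_abs, id, smul_eq_mul]
      rcases le_total 0 x with h | h
      · rw [max_eq_left h, abs_of_nonneg h]; ring
      · rw [max_eq_right h, abs_of_nonpos h]; ring
    rw [traceNorm, h2, Matrix.trace_sub, Matrix.trace_smul, Complex.sub_re, Complex.smul_re,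
      smul_eq_mul]

/-- Every effect distinguishes at most as well as the trace norm. -/
lemma two_mul_trace_mul_le_traceNorm {Y T : Matrix m m ℂ} (hY : IsSelfAdjoint Y) (h0 : 0 ≤ T)
    (h1 : T ≤ 1) : 2 * (T * Y).trace.re ≤ traceNorm Y + Y.trace.re := by
  obtain ⟨P, Q, -, -, hQ, hYQ, -, hn⟩ := exists_positivePart hY
  have := trace_mul_le_trace_mul h0 hYQ
  have := trace_mul_le_trace hQ h1
  linarith

lemma traceNorm_sub_le {A B : Matrix m m ℂ} (hA : 0 ≤ A) (hB : 0 ≤ B) :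
    traceNorm (A - B) ≤ A.trace.re + B.trace.re := by
  obtain ⟨P, Q, hP0, hP1, hQ, hYQ, hPQ, hn⟩ :=
    exists_positivePart (hA.isSelfAdjoint.sub hB.isSelfAdjoint)
  have h1 := trace_mul_le_trace hA hP1
  have h2 := trace_mul_nonneg hP0 hB
  rw [Matrix.mul_sub] at hPQ
  have h3 := congrArg (fun M => M.trace.re) hPQ
  simp only [Matrix.trace_sub, Complex.sub_re] at h3 hn
  linarith

lemma rpow_mul_rpow {A : Matrix m m ℂ} (hA : 0 ≤ A) {s : ℝ} (hs0 : 0 < s) (hs1 : s < 1) :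
    cfc (fun t : ℝ => t ^ s) A * cfc (fun t : ℝ => t ^ (1 - s)) A = A := by
  have hc := continuousOn_spectrum A
  rw [← cfc_mul _ _ A (hc _) (hc _)]
  conv_rhs => rw [← cfc_id ℝ A]
  refine cfc_congr fun x hx => ?_
  have hx : 0 ≤ x := spectrum_nonneg_of_nonneg hA hx
  simp only [id]
  rw [← Real.rpow_add_of_nonneg hx hs0.le (by linarith)]
  simp

lemma cfc_rpow_mono {A B : Matrix m m ℂ} (hA : 0 ≤ A) (h : A ≤ B) {s : ℝ} (hs0 : 0 ≤ s)
    (hs1 : s ≤ 1) : cfc (fun t : ℝ => t ^ s) A ≤ cfc (fun t : ℝ => t ^ s) B := by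
  rw [← CFC.rpow_eq_cfc_real hA, ← CFC.rpow_eq_cfc_real (hA.trans h)]
  exact CFC.rpow_le_rpow ⟨hs0, hs1⟩ h

lemma cfc_rpow_nonneg {A : Matrix m m ℂ} (hA : 0 ≤ A) (s : ℝ) :
    0 ≤ cfc (fun t : ℝ => t ^ s) A :=
  cfc_nonneg fun _ hx => Real.rpow_nonneg (spectrum_nonneg_of_nonneg hA hx) _

/-- The quantum Chernoff bound of Audenaert et al. -/
lemma exists_test_le_trace_rpow {A C : Matrix m m ℂ} (hA : 0 ≤ A) (hC : 0 ≤ C) {s : ℝ}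
    (hs0 : 0 < s) (hs1 : s < 1) :
    ∃ P : Matrix m m ℂ, 0 ≤ P ∧ P ≤ 1 ∧ A.trace.re - (P * A).trace.re + (P * C).trace.re ≤
      (cfc (fun t : ℝ => t ^ s) A * cfc (fun t : ℝ => t ^ (1 - s)) C).trace.re := by
  obtain ⟨P, Q, hP0, hP1, hQ, hYQ, hPQ, -⟩ :=
    exists_positivePart (hA.isSelfAdjoint.sub hC.isSelfAdjoint)
  refine ⟨P, hP0, hP1, ?_⟩
  -- `G = C + (A - C)₊` dominates both `A` and `C`. Operator monotonicity of powers in `[0, 1]` then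
  -- gives `Tr A^s (A^{1-s} - C^{1-s}) ≤ Tr G^s (G^{1-s} - C^{1-s}) ≤ Tr G - Tr C = Tr Q`, and `Tr Q
  -- = Tr[P (A - C)]`.
  have hAG : A ≤ C + Q := by simpa [add_comm, sub_le_iff_le_add] using hYQ
  have hCG : C ≤ C + Q := le_add_of_nonneg_right hQ
  set G := C + Q with hG
  have hG0 : 0 ≤ G := hA.trans hAG
  have hr0 : 0 ≤ 1 - s := by linarith
  have hr1 : 1 - s ≤ 1 := by linarith
  have h1 := trace_mul_le_trace_mul (sub_nonneg.mpr (cfc_rpow_mono hC hCG hr0 hr1))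
    (cfc_rpow_mono hA hAG hs0.le hs1.le)
  have h2 := trace_mul_le_trace_mul (cfc_rpow_nonneg hA s) (cfc_rpow_mono hA hAG hr0 hr1)
  have h3 := trace_mul_le_trace_mul (cfc_rpow_nonneg hC (1 - s)) (cfc_rpow_mono hC hCG hs0.le hs1.le)
  have e1 := congrArg (fun M => M.trace.re) (rpow_mul_rpow hA hs0 hs1)
  have e2 := congrArg (fun M => M.trace.re) (rpow_mul_rpow hC hs0 hs1)
  have e3 := congrArg (fun M => M.trace.re) (rpow_mul_rpow hG0 hs0 hs1)
  have e4 := congrArg (fun M => M.trace.re) hPQ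
  have e5 : G.trace.re = C.trace.re + Q.trace.re := by simp [hG]
  simp only [Matrix.sub_mul, Matrix.mul_sub, Matrix.trace_sub, Complex.sub_re] at *
  rw [Matrix.trace_mul_comm (cfc (fun t : ℝ => t ^ s) C)] at e2
  rw [Matrix.trace_mul_comm (cfc (fun t : ℝ => t ^ s) G)] at e3
  rw [Matrix.trace_mul_comm (cfc (fun t : ℝ => t ^ (1 - s)) G) (cfc (fun t : ℝ => t ^ s) A),
    Matrix.trace_mul_comm (cfc (fun t : ℝ => t ^ (1 - s)) C) (cfc (fun t : ℝ => t ^ s) A)] at h1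
  linarith

end Effects

/-! ### The pretty good measurement. -/

section PrettyGood

variable {m : Type*} [Fintype m] [DecidableEq m]

/-- The square root `S` of a regularized positive matrix and its inverse `R`. -/
lemma exists_sqrt_inv {A : Matrix m m ℂ} (hA : 0 ≤ A) {ε : ℝ} (hε : 0 < ε) :
    ∃ S R : Matrix m m ℂ, 0 ≤ S ∧ 0 ≤ R ∧ S * R = 1 ∧ R * S = 1 ∧ S * S = A + ε • 1 := by
  have hc := continuousOn_spectrum A
  have hpos : ∀ x ∈ spectrum ℝ A, 0 < x + ε := fun x hx =>
    add_pos_of_nonneg_of_pos (spectrum_nonneg_of_nonneg hA hx) hε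
  have hsr : cfc (fun t : ℝ => √(t + ε)) A * cfc (fun t : ℝ => (√(t + ε))⁻¹) A = 1 := by
    rw [← cfc_mul _ _ A (hc _) (hc _), ← cfc_one ℝ A]
    exact cfc_congr fun x hx => mul_inv_cancel₀ (Real.sqrt_pos.mpr (hpos x hx)).ne'
  refine ⟨cfc (fun t : ℝ => √(t + ε)) A, cfc (fun t : ℝ => (√(t + ε))⁻¹) A,
    cfc_nonneg fun x _ => by positivity, cfc_nonneg fun x _ => by positivity, hsr,
    mul_eq_one_comm.mp hsr, ?_⟩
  rw [← cfc_mul _ _ A (hc _) (hc _)]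
  conv_rhs => rw [← cfc_id ℝ A, ← cfc_one ℝ A, ← cfc_smul ε _ A (hc _),
    ← cfc_add A _ _ (hc _) (hc _)]
  refine cfc_congr fun x hx => ?_
  simp [Real.mul_self_sqrt (hpos x hx).le]

/-- A lower bound, affine in `S * S`, for the success probability `Tr[θ S⁻¹ θ S⁻¹]` of the
pretty good measurement. -/
lemma le_trace_prettyGood {θ P S R : Matrix m m ℂ} (hθ : 0 ≤ θ) (hP0 : 0 ≤ P) (hP1 : P ≤ 1)
    (hS : 0 ≤ S) (hR : 0 ≤ R) (hSR : S * R = 1) (hRS : R * S = 1) :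
    2 * (P * θ).trace.re - (P * (S * S)).trace.re ≤ (θ * (R * θ * R)).trace.re := by
  have hK : IsSelfAdjoint (θ - S * P * S) :=
    hθ.isSelfAdjoint.sub (hS.isSelfAdjoint.conjugate_nonneg hP0).isSelfAdjoint
  -- Completing the square: `Tr[K R K R] ≥ 0` for `K = θ - S P S`. The quadratic term `Tr[P S P S]`
  -- is then relaxed to `Tr[P S S]`, because `P ≤ 1`; this makes the bound affine.
  have h1 := trace_mul_nonneg (hK.conjugate_nonneg hR) hR
  have h2 : S * P * S ≤ S * S := by
    simpa using hS.isSelfAdjoint.conjugate_le_conjugate hP1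
  have h3 := trace_mul_le_trace_mul hP0 h2
  have e : (θ - S * P * S) * R * (θ - S * P * S) * R =
      θ * (R * θ * R) - θ * (R * S) * P * (S * R) - S * P * (S * R) * θ * R
        + S * P * (S * R) * S * P * (S * R) := by
    noncomm_ring
  have c1 : (S * P * θ * R).trace = (P * θ).trace := by
    rw [Matrix.mul_assoc, Matrix.mul_assoc, Matrix.trace_mul_comm, Matrix.mul_assoc,
      Matrix.mul_assoc, hRS, Matrix.mul_one]
  have c2 : (S * P * S * P).trace = (P * (S * P * S)).trace := Matrix.trace_mul_comm _ _
  rw [e, hRS, hSR] at h1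
  simp only [Matrix.mul_one, Matrix.trace_add, Matrix.trace_sub, Complex.add_re, Complex.sub_re,
    c1, c2, Matrix.trace_mul_comm θ P] at h1
  linarith

/-- The pretty good measurement that distinguishes `∑ i, θ i` from `B`, compared with
arbitrary tests `P i`. -/
lemma exists_test_sum_le {ι : Type*} (s : Finset ι) (θ P : ι → Matrix m m ℂ)
    (hθ : ∀ i, 0 ≤ θ i) (hP0 : ∀ i, 0 ≤ P i) (hP1 : ∀ i, P i ≤ 1) {B : Matrix m m ℂ}
    (hB : 0 ≤ B) :
    ∃ T : Matrix m m ℂ, 0 ≤ T ∧ T ≤ 1 ∧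
      ∑ i ∈ s, (4 * (P i * θ i).trace.re - 2 * (P i * (∑ j ∈ s, θ j + B)).trace.re
        - (θ i).trace.re) ≤ (T * (∑ j ∈ s, θ j - B)).trace.re := by
  set A := ∑ j ∈ s, θ j with hA
  have hA0 : 0 ≤ A := Finset.sum_nonneg fun i _ => hθ i
  obtain ⟨P', Q, hP0', hP1', hQ, hYQ, hPQ, -⟩ :=
    exists_positivePart (hA0.isSelfAdjoint.sub hB.isSelfAdjoint)
  -- The witness is the optimal projection, attaining `Tr Q`; the pretty good effect `R * A * R` is
  -- only a competitor. The witness thus does not depend on the regularization `ε`, which is needed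
  -- since `A + B` may be singular.
  refine ⟨P', hP0', hP1', ?_⟩
  rw [hPQ]
  have key : ∀ ε : ℝ, 0 < ε →
      ∑ i ∈ s, (4 * (P i * θ i).trace.re - 2 * (P i * (A + B)).trace.re - (θ i).trace.re)
        ≤ Q.trace.re + ε * (2 * ∑ i ∈ s, (P i).trace.re) := by
    intro ε hε
    obtain ⟨S, R, hS, hR, hSR, hRS, hSS⟩ := exists_sqrt_inv (add_nonneg hA0 hB) hε
    have hAS : A ≤ S * S := by
      rw [hSS, add_assoc]
      exact le_add_of_nonneg_right (add_nonneg hB (smul_nonneg hε.le zero_le_one))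
    have hBS : B ≤ S * S - A := by
      rw [hSS, add_assoc, add_sub_cancel_left]
      exact le_add_of_nonneg_right (smul_nonneg hε.le zero_le_one)
    have hT0 : 0 ≤ R * A * R := hR.isSelfAdjoint.conjugate_nonneg hA0
    have hT1 : R * A * R ≤ 1 := by
      refine (hR.isSelfAdjoint.conjugate_le_conjugate hAS).trans_eq ?_
      rw [← mul_assoc, hRS, one_mul, hSR]
    have h1 : (R * A * R * (A - B)).trace.re ≤ Q.trace.re :=
      (trace_mul_le_trace_mul hT0 hYQ).trans (trace_mul_le_trace hQ hT1)
    have h2 := trace_mul_le_trace_mul hT0 hBS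
    have e1 : (R * A * R * (S * S)).trace = A.trace := by
      rw [Matrix.trace_mul_comm, show S * S * (R * A * R) = S * (S * R) * A * R by
        noncomm_ring, hSR, mul_one, Matrix.mul_assoc, Matrix.trace_mul_comm, Matrix.mul_assoc, hRS,
        mul_one]
    -- Each `θ i ≤ A`, so the overlap of `A` with its own effect dominates the diagonal terms.
    have h3 : ∑ i ∈ s, (θ i * (R * θ i * R)).trace.re ≤ (R * A * R * A).trace.re := by
      conv_rhs => rw [Matrix.trace_mul_comm, hA, Finset.sum_mul, Matrix.trace_sum, Complex.re_sum]
      refine Finset.sum_le_sum fun i hi => trace_mul_le_trace_mul (hθ i) ?_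
      exact hR.isSelfAdjoint.conjugate_le_conjugate
        (Finset.single_le_sum (f := θ) (fun j _ => hθ j) hi)
    have h4 : ∑ i ∈ s, (2 * (P i * θ i).trace.re - (P i * (A + B)).trace.re
        - ε * (P i).trace.re) ≤ ∑ i ∈ s, (θ i * (R * θ i * R)).trace.re := by
      refine Finset.sum_le_sum fun i _ => ?_
      have := le_trace_prettyGood (hθ i) (hP0 i) (hP1 i) hS hR hSR hRS
      rw [hSS, Matrix.mul_add (P i) (A + B), Matrix.trace_add, Complex.add_re] at this
      simpa [sub_sub] using this
    have h5 : A.trace.re = ∑ i ∈ s, (θ i).trace.re := by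
      rw [hA, Matrix.trace_sum, Complex.re_sum]
    simp only [Matrix.mul_sub, Matrix.trace_sub, Complex.sub_re, e1, Finset.sum_sub_distrib,
      ← Finset.mul_sum] at *
    linarith
  have hK : 0 ≤ 2 * ∑ i ∈ s, (P i).trace.re :=
    mul_nonneg zero_le_two (Finset.sum_nonneg fun i _ => trace_re_nonneg (hP0 i))
  set K := 2 * ∑ i ∈ s, (P i).trace.re
  -- The limit `ε → 0`; the `+ 1` covers `K = 0`.
  refine le_of_forall_pos_le_add fun δ hδ => (key (δ / (K + 1)) (by positivity)).trans ?_
  have : δ / (K + 1) * K ≤ δ := by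
    rw [div_mul_eq_mul_div, div_le_iff₀ (by positivity)]
    nlinarith
  linarith

end PrettyGood

/-! ### Functional calculus by polynomial interpolation. -/

section Polynomial

/-- Interpolation of a function on a finite set. -/
lemma exists_polynomial_eqOn (f : ℝ → ℝ) {S : Set ℝ} (hS : S.Finite) :
    ∃ p : Polynomial ℝ, S.EqOn f p.eval := by
  refine ⟨Lagrange.interpolate hS.toFinset id f, fun t ht => ?_⟩
  exact (Lagrange.eval_interpolate_at_node f (Set.injOn_id _) (hS.mem_toFinset.mpr ht)).symm

lemma cfc_eq_aeval {m : Type*} [Fintype m] [DecidableEq m] {f : ℝ → ℝ} {p : Polynomial ℝ}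
    {A : Matrix m m ℂ} (hA : IsSelfAdjoint A) (h : (spectrum ℝ A).EqOn f p.eval) :
    cfc f A = Polynomial.aeval A p := by
  rw [cfc_congr h, cfc_polynomial p A]

end Polynomial

/-! ### Block diagonal operators. -/

section BlockDiagonal

variable {X E : Type*} [DecidableEq X]

/-- The block diagonal operator `∑ x, |x⟩⟨x| ⊗ T x`. -/
def blockDiag (T : X → Matrix E E ℂ) : Matrix (X × E) (X × E) ℂ :=
  Matrix.of fun a b => if a.1 = b.1 then T a.1 a.2 b.2 else 0

lemma blockDiag_apply (T : X → Matrix E E ℂ) (a b : X × E) :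
    blockDiag T a b = if a.1 = b.1 then T a.1 a.2 b.2 else 0 := rfl

@[simp] lemma block_blockDiag (T : X → Matrix E E ℂ) (x : X) : block (blockDiag T) x = T x := by
  ext e e'
  simp [block, blockDiag_apply]

lemma blockDiag_sub (S T : X → Matrix E E ℂ) :
    blockDiag S - blockDiag T = blockDiag (S - T) := by
  ext a b
  simp only [blockDiag_apply, Matrix.sub_apply, Pi.sub_apply]
  split_ifs <;> simp

variable [Fintype X] [Fintype E]

lemma blockDiag_mul (S T : X → Matrix E E ℂ) :
    blockDiag S * blockDiag T = blockDiag (S * T) := by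
  ext a b
  simp only [blockDiag_apply, Matrix.mul_apply, Pi.mul_apply, Fintype.sum_prod_type]
  rw [Finset.sum_eq_single a.1]
  · by_cases h : a.1 = b.1 <;> simp [h]
  · intro x _ hx
    simp [hx.symm]
  · simp

lemma trace_blockDiag (T : X → Matrix E E ℂ) :
    (blockDiag T).trace = ∑ x, (T x).trace := by
  simp [Matrix.trace, blockDiag_apply, Fintype.sum_prod_type]

variable [DecidableEq E]

/-- `blockDiag` as a homomorphism of star algebras. -/
def blockDiagHom : (X → Matrix E E ℂ) →⋆ₐ[ℝ] Matrix (X × E) (X × E) ℂ where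
  toFun := blockDiag
  map_one' := by
    ext a b
    simp only [blockDiag_apply, Pi.one_apply, Matrix.one_apply, Prod.ext_iff]
    split_ifs <;> simp_all
  map_mul' S T := (blockDiag_mul S T).symm
  map_zero' := by
    ext a b
    simp [blockDiag_apply]
  map_add' S T := by
    ext a b
    simp only [blockDiag_apply, Matrix.add_apply, Pi.add_apply]
    split_ifs <;> simp
  commutes' r := by
    ext a b
    simp only [blockDiag_apply, Matrix.algebraMap_matrix_apply, Pi.algebraMap_apply, Prod.ext_iff]
    split_ifs <;> simp_all
  map_star' T := by
    ext a b
    simp only [blockDiag_apply, Matrix.star_apply, Pi.star_apply]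
    by_cases h : a.1 = b.1
    · simp [h]
    · simp [h, Ne.symm h]

/-- A single polynomial interpolates `f` on the spectra of the whole operator and of all its blocks,
and polynomials commute with algebra homomorphisms. -/
lemma cfc_blockDiag (f : ℝ → ℝ) {T : X → Matrix E E ℂ} (hT : ∀ x, IsSelfAdjoint (T x)) :
    cfc f (blockDiag T) = blockDiag fun x => cfc f (T x) := by
  have hT' : IsSelfAdjoint (blockDiag T) :=
    (show IsSelfAdjoint T from funext hT).map (blockDiagHom (X := X) (E := E))
  obtain ⟨p, hp⟩ := exists_polynomial_eqOn f
    ((Matrix.finite_real_spectrum (A := blockDiag T)).union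
      (Set.finite_iUnion fun x => Matrix.finite_real_spectrum (A := T x)))
  rw [cfc_eq_aeval hT' fun t ht => hp (Or.inl ht)]
  have h1 : ∀ x, cfc f (T x) = Polynomial.aeval T p x := fun x => by
    rw [cfc_eq_aeval (hT x) fun t ht => hp (Or.inr (Set.mem_iUnion.mpr ⟨x, ht⟩))]
    exact Polynomial.aeval_algHom_apply (Pi.evalAlgHom ℝ (fun _ : X => Matrix E E ℂ) x) T p
  simp only [h1]
  exact Polynomial.aeval_algHom_apply (blockDiagHom (X := X) (E := E)).toAlgHom T p

lemma blockDiag_nonneg {T : X → Matrix E E ℂ} (hT : ∀ x, 0 ≤ T x) : 0 ≤ blockDiag T := by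
  choose C hC using fun x => CStarAlgebra.nonneg_iff_eq_star_mul_self.mp (hT x)
  have : blockDiag T = star (blockDiagHom C) * blockDiagHom C := by
    rw [← map_star, ← map_mul, show T = star C * C from funext hC]
    rfl
  rw [this]
  exact star_mul_self_nonneg _

lemma blockDiag_le_one {T : X → Matrix E E ℂ} (hT : ∀ x, T x ≤ 1) : blockDiag T ≤ 1 := by
  rw [← map_one (blockDiagHom (X := X) (E := E))]
  refine sub_nonneg.mp ?_
  change 0 ≤ blockDiag 1 - blockDiag T
  rw [blockDiag_sub]
  exact blockDiag_nonneg fun x => sub_nonneg.mpr (hT x)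

end BlockDiagonal

/-! ### Hashed and uniform states as block diagonal operators. -/

section Hash

variable {X Z E : Type*} [Fintype X]

lemma hashMap_eq_blockDiag [DecidableEq Z] (h : X → Z) (θ : Matrix (X × E) (X × E) ℂ) :
    hashMap h θ = blockDiag fun z => ∑ x with h x = z, block θ x := by
  ext a b
  simp only [hashMap, blockDiag_apply, Matrix.sum_apply, Matrix.kroneckerMap_apply,
    Matrix.single_apply, Finset.sum_filter]
  split_ifs with hab
  · exact Finset.sum_congr rfl fun x _ => by rw [← hab]; split_ifs <;> simp_all
  · exact Finset.sum_eq_zero fun x _ => by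
      rw [if_neg fun hh => hab (hh.1.symm.trans hh.2), zero_mul]

lemma randomizingMap_eq_blockDiag [Fintype Z] [DecidableEq Z] (θ : Matrix (X × E) (X × E) ℂ) :
    randomizingMap Z θ = blockDiag fun _ : Z => (Fintype.card Z : ℂ)⁻¹ • traceLeft θ := by
  ext a b
  simp only [randomizingMap, blockDiag_apply, Matrix.kroneckerMap_apply, Matrix.smul_apply,
    Matrix.one_apply, smul_eq_mul]
  split_ifs <;> simp

lemma one_kronecker_eq_blockDiag [DecidableEq X] (σ : Matrix E E ℂ) :
    (1 : Matrix X X ℂ) ⊗ₖ σ = blockDiag fun _ : X => σ := by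
  ext a b
  simp only [blockDiag_apply, Matrix.kroneckerMap_apply, Matrix.one_apply]
  split_ifs <;> simp

end Hash

/-! ### Collision probability of the hash function. -/

section Collision

variable {X Z : Type*} [Fintype X] [DecidableEq X] [Fintype Z] [DecidableEq Z]

lemma PMF.sum_toReal {α : Type*} [Fintype α] (q : PMF α) : ∑ a, (q a).toReal = 1 := by
  have := q.tsum_coe
  rw [tsum_fintype] at this
  rw [← ENNReal.toReal_sum fun a _ => q.apply_ne_top a, this, ENNReal.toReal_one]

/-- A collision is the disjoint union over `z` of the events `h x = h x' = z`, each of probability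
`M⁻²`. This is all that the converse uses of universality. -/
lemma StronglyTwoUniversal.collision {q : PMF (X → Z)} (hq : StronglyTwoUniversal q)
    {x x' : X} (hx : x ≠ x') :
    ∑ h : X → Z, (q h).toReal * (if h x' = h x then 1 else 0) = (Fintype.card Z : ℝ)⁻¹ := by
  have h1 : ∀ z : Z, ∑ h : X → Z, (q h).toReal * (if h x = z ∧ h x' = z then 1 else 0) =
      1 / (Fintype.card Z : ℝ) ^ 2 := by
    intro z
    have := congrArg ENNReal.toReal (hq x x' hx z z)
    rw [PMF.toOuterMeasure_apply_fintype, ENNReal.toReal_sum] at this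
    · simp only [ENNReal.toReal_div, ENNReal.toReal_pow, ENNReal.toReal_one,
        ENNReal.toReal_natCast] at this
      rw [← this]
      refine Finset.sum_congr rfl fun h _ => ?_
      by_cases hh : h x = z ∧ h x' = z <;> simp [Set.indicator, hh]
    · intro h _
      by_cases hh : h x = z ∧ h x' = z <;> simp [Set.indicator, hh, q.apply_ne_top]
  have h2 : ∀ h : X → Z, (q h).toReal * (if h x' = h x then 1 else 0) =
      ∑ z, (q h).toReal * (if h x = z ∧ h x' = z then (1 : ℝ) else 0) := by
    intro h
    rw [← Finset.mul_sum]
    congr 1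
    rw [Finset.sum_eq_single (h x)]
    · simp
    · intro z _ hz
      simp [hz.symm]
    · simp
  rw [Finset.sum_congr rfl fun h _ => h2 h, Finset.sum_comm, Finset.sum_congr rfl fun z _ => h1 z]
  rw [Finset.sum_const, Finset.card_univ, nsmul_eq_mul]
  rcases eq_or_ne (Fintype.card Z : ℝ) 0 with h0 | h0
  · simp [h0]
  · field_simp

end Collision

/-! ### The one-shot strong converse. -/

section OneShot

lemma cfc_rpow_smul {m : Type*} [Fintype m] [DecidableEq m] {A : Matrix m m ℂ} (hA : 0 ≤ A)
    {c : ℝ} (hc : 0 ≤ c) (r : ℝ) :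
    cfc (fun t : ℝ => t ^ r) (c • A) = c ^ r • cfc (fun t : ℝ => t ^ r) A := by
  have hct := continuousOn_spectrum A
  have h1 : c • A = cfc (fun t : ℝ => c * t) A := by
    rw [cfc_const_mul c _ A (hct _), cfc_id' ℝ A]
  rw [h1, ← cfc_comp' (fun t : ℝ => t ^ r) (fun t : ℝ => c * t) A
    ((Matrix.finite_real_spectrum.image _).continuousOn _) (hct _), ← cfc_smul _ _ A (hct _)]
  exact cfc_congr fun x hx => Real.mul_rpow hc (spectrum_nonneg_of_nonneg hA hx)

variable {X Z E : Type*} [Fintype X] [DecidableEq X] [Fintype Z] [DecidableEq Z] [Fintype E]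
  [DecidableEq E] {θ : Matrix (X × E) (X × E) ℂ}

lemma re_trace_traceLeft : (traceLeft θ).trace.re = ∑ x, (block θ x).trace.re := by
  rw [traceLeft, Matrix.trace_sum, Complex.re_sum]

lemma re_trace_hashMap (h : X → Z) : (hashMap h θ).trace.re = (traceLeft θ).trace.re := by
  rw [hashMap_eq_blockDiag, trace_blockDiag, Complex.re_sum, re_trace_traceLeft]
  simp only [Matrix.trace_sum, Complex.re_sum]
  exact Finset.sum_fiberwise Finset.univ h _

lemma re_trace_randomizingMap [Nonempty Z] :
    (randomizingMap Z θ).trace.re = (traceLeft θ).trace.re := by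
  rw [randomizingMap_eq_blockDiag, trace_blockDiag, Finset.sum_const, Finset.card_univ,
    Matrix.trace_smul, nsmul_eq_mul, smul_eq_mul, ← mul_assoc, mul_inv_cancel₀, one_mul]
  exact Nat.cast_ne_zero.mpr Fintype.card_ne_zero

lemma hashMap_nonneg (hθ : ∀ x, 0 ≤ block θ x) (h : X → Z) : 0 ≤ hashMap h θ := by
  rw [hashMap_eq_blockDiag]
  exact blockDiag_nonneg fun z => Finset.sum_nonneg fun x _ => hθ x

lemma traceLeft_nonneg (hθ : ∀ x, 0 ≤ block θ x) : 0 ≤ traceLeft θ :=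
  Finset.sum_nonneg fun x _ => hθ x

lemma inv_card_smul_eq (σ : Matrix E E ℂ) :
    (Fintype.card Z : ℂ)⁻¹ • σ = (Fintype.card Z : ℝ)⁻¹ • σ := by
  ext i j
  simp

lemma randomizingMap_nonneg (hθ : ∀ x, 0 ≤ block θ x) : 0 ≤ randomizingMap Z θ := by
  rw [randomizingMap_eq_blockDiag, inv_card_smul_eq]
  exact blockDiag_nonneg fun z => smul_nonneg (by positivity) (traceLeft_nonneg hθ)

/-- The trace distance never exceeds one. -/
lemma expTraceDist_le_one (q : PMF (X → Z)) (hθ : ∀ x, 0 ≤ block θ x)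
    (htr : (traceLeft θ).trace.re = 1) [Nonempty Z] : expTraceDist q θ ≤ 1 := by
  have h1 : ∑ h : X → Z, (q h).toReal * traceNorm (hashMap h θ - randomizingMap Z θ) ≤
      ∑ h : X → Z, (q h).toReal * 2 := by
    refine Finset.sum_le_sum fun h _ => mul_le_mul_of_nonneg_left ?_ ENNReal.toReal_nonneg
    refine (traceNorm_sub_le (hashMap_nonneg hθ h) (randomizingMap_nonneg hθ)).trans_eq ?_
    rw [re_trace_hashMap, re_trace_randomizingMap, htr]
    norm_num
  rw [← Finset.sum_mul, PMF.sum_toReal] at h1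
  rw [expTraceDist]
  linarith

/-- A lower bound on the trace distance for one hash function, by arbitrary tests `P x`. -/
lemma le_half_traceNorm_hashMap [Nonempty Z] (hθ : ∀ x, 0 ≤ block θ x) (h : X → Z)
    {P : X → Matrix E E ℂ} (hP0 : ∀ x, 0 ≤ P x) (hP1 : ∀ x, P x ≤ 1) :
    ∑ x, (4 * (P x * block θ x).trace.re
        - 2 * ∑ x', (if h x' = h x then 1 else 0) * (P x * block θ x').trace.re
        - 2 * (P x * ((Fintype.card Z : ℝ)⁻¹ • traceLeft θ)).trace.re - (block θ x).trace.re) ≤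
      1 / 2 * traceNorm (hashMap h θ - randomizingMap Z θ) := by
  set B := (Fintype.card Z : ℝ)⁻¹ • traceLeft θ with hB
  have hB0 : 0 ≤ B := smul_nonneg (by positivity) (traceLeft_nonneg hθ)
  choose T hT0 hT1 hT using fun z : Z =>
    exists_test_sum_le {x | h x = z} (block θ) P hθ hP0 hP1 hB0
  -- The tests for the separate outputs form one block diagonal effect; equality of the traces
  -- removes the trace term.
  have h1 := two_mul_trace_mul_le_traceNorm
    ((hashMap_nonneg hθ h).isSelfAdjoint.sub (randomizingMap_nonneg (Z := Z) hθ).isSelfAdjoint)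
    (blockDiag_nonneg hT0) (blockDiag_le_one hT1)
  rw [Matrix.trace_sub, Complex.sub_re, re_trace_hashMap, re_trace_randomizingMap, sub_self,
    add_zero] at h1
  have h2 : (blockDiag T * (hashMap h θ - randomizingMap Z θ)).trace.re =
      ∑ z, (T z * (∑ x with h x = z, block θ x - B)).trace.re := by
    rw [hashMap_eq_blockDiag, randomizingMap_eq_blockDiag, inv_card_smul_eq, blockDiag_sub,
      blockDiag_mul, trace_blockDiag, Complex.re_sum]
    rfl
  have h3 := Finset.sum_le_sum fun z (_ : z ∈ Finset.univ) => hT z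
  rw [← h2] at h3
  have h4 : ∀ z, ∑ x with h x = z, (4 * (P x * block θ x).trace.re
        - 2 * (P x * (∑ x' with h x' = z, block θ x' + B)).trace.re - (block θ x).trace.re) =
      ∑ x with h x = z, (4 * (P x * block θ x).trace.re
        - 2 * ∑ x', (if h x' = h x then 1 else 0) * (P x * block θ x').trace.re
        - 2 * (P x * B).trace.re - (block θ x).trace.re) := by
    intro z
    refine Finset.sum_congr rfl fun x hx => ?_
    rw [← (Finset.mem_filter.mp hx).2]
    simp only [Matrix.mul_add, Matrix.mul_sum, Matrix.trace_add, Matrix.trace_sum, Complex.add_re,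
      Complex.re_sum, ite_mul, one_mul, zero_mul, ← Finset.sum_filter]
    ring
  rw [Finset.sum_congr rfl fun z _ => h4 z, Finset.sum_fiberwise] at h3
  linarith

/-- One-shot strong converse for privacy amplification against quantum side information. -/
theorem one_sub_le_expTraceDist [Nonempty Z] {q : PMF (X → Z)} (hq : StronglyTwoUniversal q)
    (hθ : ∀ x, 0 ≤ block θ x) (htr : (traceLeft θ).trace.re = 1) {s : ℝ} (hs0 : 0 < s)
    (hs1 : s < 1) :
    1 - 4 * (((Fintype.card Z : ℝ)⁻¹) ^ (1 - s) *
      ∑ x, (cfc (fun t : ℝ => t ^ s) (block θ x) *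
        cfc (fun t : ℝ => t ^ (1 - s)) (traceLeft θ)).trace.re) ≤ expTraceDist q θ := by
  have hσ := traceLeft_nonneg hθ
  set M := (Fintype.card Z : ℝ) with hM
  have hM0 : 0 < M := Nat.cast_pos.mpr Fintype.card_pos
  -- The factor 2: after averaging, `Tr[P x σ] / M` is charged twice, once by the uniform state and
  -- once by collisions.
  choose P hP0 hP1 hP using fun x => exists_test_le_trace_rpow (hθ x)
    (smul_nonneg (show (0 : ℝ) ≤ 2 * M⁻¹ by positivity) hσ) hs0 hs1
  set b : X → X → ℝ := fun x x' => (P x * block θ x').trace.re with hb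
  have hb0 : ∀ x x', 0 ≤ b x x' := fun x x' => trace_mul_nonneg (hP0 x) (hθ x')
  set c : X → ℝ := fun x => (P x * (M⁻¹ • traceLeft θ)).trace.re with hc
  have hcb : ∀ x, c x = M⁻¹ * ∑ x', b x x' := fun x => by
    simp only [hc, hb, traceLeft, Matrix.mul_smul, Matrix.trace_smul, Complex.smul_re, smul_eq_mul,
      Matrix.mul_sum, Matrix.trace_sum, Complex.re_sum]
  set t : X → ℝ := fun x => (block θ x).trace.re with ht
  set Q : X → ℝ := fun x => (cfc (fun t : ℝ => t ^ s) (block θ x) *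
        cfc (fun t : ℝ => t ^ (1 - s)) (traceLeft θ)).trace.re with hQ
  have hQ0 : ∀ x, 0 ≤ Q x := fun x =>
    trace_mul_nonneg (cfc_rpow_nonneg (hθ x) _) (cfc_rpow_nonneg hσ _)
  -- Here `2 ^ (1 - s)` is rounded up to 2; the other factor 2 of the final 4 comes from `t - 2 (t -
  -- b + 2 c)`.
  have hPQ : ∀ x, t x - b x x + 2 * c x ≤ 2 * (M⁻¹ ^ (1 - s) * Q x) := by
    intro x
    have h1 := hP x
    have h2 : c x = M⁻¹ * (P x * traceLeft θ).trace.re := by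
      simp only [hc, Matrix.mul_smul, Matrix.trace_smul, Complex.smul_re, smul_eq_mul]
    rw [cfc_rpow_smul hσ (by positivity)] at h1
    simp only [Matrix.mul_smul, Matrix.trace_smul, Complex.smul_re, smul_eq_mul] at h1
    rw [Real.mul_rpow zero_le_two (by positivity), mul_assoc, mul_assoc, ← h2] at h1
    refine h1.trans (mul_le_mul_of_nonneg_right ?_ (mul_nonneg (by positivity) (hQ0 x)))
    calc (2 : ℝ) ^ (1 - s) ≤ 2 ^ (1 : ℝ) :=
          Real.rpow_le_rpow_of_exponent_le one_le_two (by linarith)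
      _ = 2 := Real.rpow_one 2
  -- The surplus `M⁻¹` on the diagonal completes the collision terms to the full sum `c x`.
  have hcoll : ∀ x x', ∑ h : X → Z, (q h).toReal * (if h x' = h x then 1 else 0) ≤
      (if x = x' then 1 else 0) + M⁻¹ := by
    intro x x'
    by_cases hx : x = x'
    · have : 0 ≤ M⁻¹ := by positivity
      simp [hx, PMF.sum_toReal, this]
    · rw [hq.collision hx, if_neg hx, zero_add]
  have h1 : ∑ h : X → Z, (q h).toReal * ∑ x, (4 * b x x
        - 2 * ∑ x', (if h x' = h x then 1 else 0) * b x x' - 2 * c x - t x) ≤ expTraceDist q θ := by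
    rw [expTraceDist, Finset.mul_sum]
    refine Finset.sum_le_sum fun h _ => ?_
    rw [mul_left_comm]
    exact mul_le_mul_of_nonneg_left (le_half_traceNorm_hashMap hθ h hP0 hP1) ENNReal.toReal_nonneg
  have h2 : ∑ h : X → Z, (q h).toReal * ∑ x, (4 * b x x
        - 2 * ∑ x', (if h x' = h x then 1 else 0) * b x x' - 2 * c x - t x) =
      ∑ x, (4 * b x x - 2 * ∑ x', (∑ h : X → Z, (q h).toReal * (if h x' = h x then 1 else 0))
        * b x x' - 2 * c x - t x) := by
    simp only [Finset.mul_sum (Finset.univ : Finset X) _ (_ : ℝ)]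
    rw [Finset.sum_comm]
    refine Finset.sum_congr rfl fun x _ => ?_
    have hsum := PMF.sum_toReal q
    have e : ∑ h : X → Z, (q h).toReal * ∑ x', (if h x' = h x then (1 : ℝ) else 0) * b x x' =
        ∑ x', (∑ h : X → Z, (q h).toReal * (if h x' = h x then 1 else 0)) * b x x' := by
      simp only [Finset.mul_sum, Finset.sum_mul, mul_assoc]
      exact Finset.sum_comm
    rw [← Finset.mul_sum, ← e]
    simp only [← Finset.mul_sum]
    have e' : ∀ h : X → Z, (q h).toReal * (4 * b x x
        - 2 * ∑ x', (if h x' = h x then 1 else 0) * b x x' - 2 * c x - t x) =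
        (q h).toReal * (4 * b x x - 2 * c x - t x) -
          2 * ((q h).toReal * ∑ x', (if h x' = h x then 1 else 0) * b x x') := fun h => by ring
    rw [Finset.sum_congr rfl fun h _ => e' h, Finset.sum_sub_distrib, ← Finset.sum_mul, hsum,
      ← Finset.mul_sum]
    ring
  have h3 : ∑ x, (t x - 4 * (M⁻¹ ^ (1 - s) * Q x)) ≤
      ∑ x, (4 * b x x - 2 * ∑ x', (∑ h : X → Z, (q h).toReal * (if h x' = h x then 1 else 0))
        * b x x' - 2 * c x - t x) := by
    refine Finset.sum_le_sum fun x _ => ?_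
    have h4 : ∑ x', (∑ h : X → Z, (q h).toReal * (if h x' = h x then 1 else 0)) * b x x' ≤
        ∑ x', ((if x = x' then 1 else 0) + M⁻¹) * b x x' :=
      Finset.sum_le_sum fun x' _ => mul_le_mul_of_nonneg_right (hcoll x x') (hb0 x x')
    have h5 : ∑ x', ((if x = x' then 1 else 0) + M⁻¹) * b x x' = b x x + c x := by
      simp only [add_mul, Finset.sum_add_distrib, ite_mul, one_mul, zero_mul, hcb, Finset.mul_sum]
      simp
    linarith [hPQ x]
  rw [Finset.sum_sub_distrib, ← Finset.mul_sum, ← Finset.mul_sum, ← re_trace_traceLeft, htr] at h3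
  linarith

end OneShot

/-! ### Spectral decompositions and pairs of eigenvalues. -/

section Spectral

variable {m : Type*} [Fintype m] [DecidableEq m]

/-- The real diagonal matrices in the basis given by a unitary matrix `U`. -/
def conjDiagonalHom {U : Matrix m m ℂ} (hU : U ∈ unitary (Matrix m m ℂ)) :
    (m → ℝ) →ₐ[ℝ] Matrix m m ℂ where
  toFun d := U * Matrix.diagonal (fun i => (d i : ℂ)) * star U
  map_one' := by simpa using Unitary.mul_star_self_of_mem hU
  map_mul' d e := by
    rw [show U * Matrix.diagonal (fun i => (d i : ℂ)) * star U *
        (U * Matrix.diagonal (fun i => (e i : ℂ)) * star U) =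
        U * Matrix.diagonal (fun i => (d i : ℂ)) * (star U * U) *
          Matrix.diagonal (fun i => (e i : ℂ)) * star U by noncomm_ring,
      Unitary.star_mul_self_of_mem hU, mul_one, mul_assoc U _ (Matrix.diagonal _),
      Matrix.diagonal_mul_diagonal]
    simp
  map_zero' := by simp
  map_add' d e := by
    simp only [Pi.add_apply, Complex.ofReal_add, ← Matrix.diagonal_add, mul_add, add_mul]
  commutes' r := by
    have : Matrix.diagonal (fun i => ((algebraMap ℝ (m → ℝ) r i : ℝ) : ℂ)) = r • 1 := by
      ext i j
      simp [Matrix.diagonal_apply, Matrix.one_apply]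
    rw [this, mul_smul_comm, smul_mul_assoc, mul_one, Unitary.mul_star_self_of_mem hU,
      Algebra.algebraMap_eq_smul_one]

lemma isSelfAdjoint_conj_diagonal (U : Matrix m m ℂ) (d : m → ℝ) :
    IsSelfAdjoint (U * Matrix.diagonal (fun i => (d i : ℂ)) * star U) := by
  have : IsSelfAdjoint (Matrix.diagonal (fun i => (d i : ℂ))) := by
    rw [isSelfAdjoint_iff, Matrix.star_eq_conjTranspose, Matrix.diagonal_conjTranspose]
    congr 1
    ext i
    simp
  exact this.conjugate U

lemma cfc_conj_diagonal {U : Matrix m m ℂ} (hU : U ∈ unitary (Matrix m m ℂ)) (f : ℝ → ℝ)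
    (d : m → ℝ) :
    cfc f (U * Matrix.diagonal (fun i => (d i : ℂ)) * star U) =
      U * Matrix.diagonal (fun i => (f (d i) : ℂ)) * star U := by
  obtain ⟨p, hp⟩ := exists_polynomial_eqOn f ((Matrix.finite_real_spectrum
    (A := U * Matrix.diagonal (fun i => (d i : ℂ)) * star U)).union (Set.finite_range d))
  rw [cfc_eq_aeval (isSelfAdjoint_conj_diagonal U d) fun t ht => hp (Or.inl ht)]
  have h1 : (fun i => f (d i)) = Polynomial.aeval d p := by
    ext i
    rw [hp (Or.inr ⟨i, rfl⟩)]
    simp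
  have h2 := Polynomial.aeval_algHom_apply (conjDiagonalHom hU) d p
  rw [← h1] at h2
  exact h2

lemma exists_eq_conj_diagonal {A : Matrix m m ℂ} (hA : 0 ≤ A) :
    ∃ (U : Matrix m m ℂ) (d : m → ℝ), U ∈ unitary (Matrix m m ℂ) ∧ (∀ i, 0 ≤ d i) ∧
      A = U * Matrix.diagonal (fun i => (d i : ℂ)) * star U := by
  have h := Matrix.nonneg_iff_posSemidef.mp hA
  refine ⟨h.1.eigenvectorUnitary, h.1.eigenvalues, h.1.eigenvectorUnitary.2,
    h.eigenvalues_nonneg, ?_⟩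
  conv_lhs => rw [h.1.spectral_theorem, Unitary.conjStarAlgAut_apply]
  rfl

/-- The trace of a product of functions of two positive matrices is a sum over pairs of
eigenvalues, with nonnegative weights. -/
lemma exists_trace_cfc_mul_cfc {A B : Matrix m m ℂ} (hA : 0 ≤ A) (hB : 0 ≤ B) :
    ∃ (a b : m → ℝ) (w : m → m → ℝ), (∀ i, 0 ≤ a i) ∧ (∀ j, 0 ≤ b j) ∧ (∀ i j, 0 ≤ w i j) ∧
      ∀ f g : ℝ → ℝ, (cfc f A * cfc g B).trace.re = ∑ i, ∑ j, f (a i) * g (b j) * w i j := by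
  obtain ⟨U, a, hU, ha, rfl⟩ := exists_eq_conj_diagonal hA
  obtain ⟨V, b, hV, hb, rfl⟩ := exists_eq_conj_diagonal hB
  -- The weights are the squared overlaps of the two eigenbases, hence the same for all `f` and `g`.
  refine ⟨a, b, fun i j => Complex.normSq ((star U * V) i j), ha, hb,
    fun i j => Complex.normSq_nonneg _, fun f g => ?_⟩
  rw [cfc_conj_diagonal hU, cfc_conj_diagonal hV]
  set W := star U * V with hW
  have hW' : star V * U = star W := by rw [hW, star_mul, star_star]
  rw [show U * Matrix.diagonal (fun i => (f (a i) : ℂ)) * star U *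
      (V * Matrix.diagonal (fun i => (g (b i) : ℂ)) * star V) =
      U * (Matrix.diagonal (fun i => (f (a i) : ℂ)) * W *
        Matrix.diagonal (fun i => (g (b i) : ℂ)) * star V) by rw [hW]; noncomm_ring,
    Matrix.trace_mul_comm, mul_assoc _ (star V), hW']
  simp only [Matrix.trace, Matrix.diag_apply, Matrix.mul_apply (N := star W), Matrix.mul_diagonal,
    Matrix.diagonal_mul, Matrix.star_apply, Complex.re_sum]
  refine Finset.sum_congr rfl fun i _ => Finset.sum_congr rfl fun j _ => ?_
  rw [show (f (a i) : ℂ) * W i j * (g (b j) : ℂ) * star (W i j) =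
    ((f (a i) * g (b j) : ℝ) : ℂ) * (W i j * star (W i j)) by push_cast; ring]
  rw [Complex.re_ofReal_mul, Complex.star_def, Complex.mul_conj, Complex.ofReal_re]

end Spectral

/-! ### Tensor products of matrices and their powers. -/

section Tensor

variable {ι E : Type*} [Fintype ι]

/-- The tensor product of a finite family of matrices. -/
def piTensor (A : ι → Matrix E E ℂ) : Matrix (ι → E) (ι → E) ℂ :=
  Matrix.of fun a b => ∏ i, A i (a i) (b i)

lemma piTensor_apply (A : ι → Matrix E E ℂ) (a b : ι → E) :
    piTensor A a b = ∏ i, A i (a i) (b i) := rfl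

lemma piTensor_star (A : ι → Matrix E E ℂ) : piTensor (star A) = star (piTensor A) := by
  ext a b
  simp [piTensor_apply, Matrix.star_apply]

variable [DecidableEq ι]

lemma piTensor_sum {X : Type*} [Fintype X] (T : X → Matrix E E ℂ) :
    ∑ x : ι → X, piTensor (fun i => T (x i)) = piTensor fun _ => ∑ x, T x := by
  ext a b
  simp only [Matrix.sum_apply, piTensor_apply]
  rw [Finset.prod_univ_sum, Fintype.piFinset_univ]

variable [Fintype E]

lemma piTensor_mul (A B : ι → Matrix E E ℂ) :
    piTensor A * piTensor B = piTensor (A * B) := by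
  ext a b
  simp only [Matrix.mul_apply, piTensor_apply, Pi.mul_apply, ← Finset.prod_mul_distrib]
  rw [Finset.prod_univ_sum, Fintype.piFinset_univ]

lemma trace_piTensor (A : ι → Matrix E E ℂ) : (piTensor A).trace = ∏ i, (A i).trace := by
  simp only [Matrix.trace, Matrix.diag_apply, piTensor_apply]
  rw [Finset.prod_univ_sum, Fintype.piFinset_univ]

variable [DecidableEq E]

lemma piTensor_nonneg {A : ι → Matrix E E ℂ} (hA : ∀ i, 0 ≤ A i) : 0 ≤ piTensor A := by
  choose C hC using fun i => CStarAlgebra.nonneg_iff_eq_star_mul_self.mp (hA i)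
  rw [show A = star C * C from funext hC, ← piTensor_mul, piTensor_star]
  exact star_mul_self_nonneg _

lemma piTensor_diagonal (d : ι → E → ℂ) :
    piTensor (fun i => Matrix.diagonal (d i)) = Matrix.diagonal fun a => ∏ i, d i (a i) := by
  ext a b
  rw [piTensor_apply]
  by_cases h : a = b
  · subst h
    simp
  · obtain ⟨i, hi⟩ := Function.ne_iff.mp h
    rw [Matrix.diagonal_apply_ne _ h]
    exact Finset.prod_eq_zero (Finset.mem_univ i) (Matrix.diagonal_apply_ne _ hi)

lemma piTensor_mem_unitary {U : ι → Matrix E E ℂ} (hU : ∀ i, U i ∈ unitary (Matrix E E ℂ)) :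
    piTensor U ∈ unitary (Matrix (ι → E) (ι → E) ℂ) := by
  have h1 : piTensor (1 : ι → Matrix E E ℂ) = 1 := by
    have := piTensor_diagonal (fun (_ : ι) (_ : E) => (1 : ℂ))
    simp only [Matrix.diagonal_one, Finset.prod_const_one] at this
    exact this
  rw [Unitary.mem_iff, ← piTensor_star, piTensor_mul, piTensor_mul, ← h1]
  exact ⟨congrArg piTensor (funext fun i => Unitary.star_mul_self_of_mem (hU i)),
    congrArg piTensor (funext fun i => Unitary.mul_star_self_of_mem (hU i))⟩

/-- Powers commute with tensor products. -/
lemma cfc_rpow_piTensor {A : ι → Matrix E E ℂ} (hA : ∀ i, 0 ≤ A i) (r : ℝ) :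
    cfc (fun t : ℝ => t ^ r) (piTensor A) =
      piTensor fun i => cfc (fun t : ℝ => t ^ r) (A i) := by
  choose U d hU hd hUd using fun i => exists_eq_conj_diagonal (hA i)
  have key : ∀ e : ι → E → ℝ, piTensor (fun i => U i * Matrix.diagonal (fun j => (e i j : ℂ)) *
      star (U i)) = piTensor U * Matrix.diagonal (fun a => ((∏ i, e i (a i) : ℝ) : ℂ)) *
        star (piTensor U) := by
    intro e
    push_cast
    rw [← piTensor_diagonal fun i j => (e i j : ℂ), ← piTensor_star, piTensor_mul, piTensor_mul]
    rfl
  have h1 : (fun i => cfc (fun t : ℝ => t ^ r) (A i)) = fun i => U i *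
      Matrix.diagonal (fun j => ((d i j ^ r : ℝ) : ℂ)) * star (U i) := by
    ext1 i
    rw [hUd i, cfc_conj_diagonal (hU i)]
  rw [h1, key fun i j => d i j ^ r, show A = fun i => U i *
    Matrix.diagonal (fun j => (d i j : ℂ)) * star (U i) from funext hUd, key,
    cfc_conj_diagonal (piTensor_mem_unitary hU)]
  congr 3
  ext a
  rw [Real.finsetProd_rpow _ _ fun i _ => hd i (a i)]

end Tensor

/-! ### Classical-quantum states and their tensor powers. -/

section State

variable {X E : Type*} [Fintype X] [DecidableEq X] [Fintype E] [DecidableEq E]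

namespace CQState

variable (s : CQState X E)

/-- The unnormalized conditional state `p x • ρ x`. -/
def weighted (x : X) : Matrix E E ℂ := (s.p x : ℂ) • s.ρ x

/-- The quasi-entropy `Tr[ρ_XE^β (1 ⊗ ρ_E)^(1-β)]`. -/
noncomputable def quasiEntropy (β : ℝ) : ℝ :=
  (cfc (fun t : ℝ => t ^ β) s.joint *
    cfc (fun t : ℝ => t ^ (1 - β)) ((1 : Matrix X X ℂ) ⊗ₖ traceLeft s.joint)).trace.re

lemma joint_eq_blockDiag : s.joint = blockDiag s.weighted := by
  ext a b
  simp only [joint, weighted, blockDiag_apply, Matrix.sum_apply, Matrix.smul_apply,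
    Matrix.kroneckerMap_apply, Matrix.single_apply, smul_eq_mul]
  split_ifs with h
  · rw [Finset.sum_eq_single a.1]
    · simp [h]
    · intro x _ hx
      simp [hx]
    · simp
  · exact Finset.sum_eq_zero fun x _ => by
      rw [if_neg fun hh => h (hh.1.symm.trans hh.2), zero_mul, mul_zero]

lemma weighted_nonneg (x : X) : 0 ≤ s.weighted x :=
  Matrix.nonneg_iff_posSemidef.mpr
    ((s.ρ_posSemidef x).smul (Complex.zero_le_real.mpr (s.p_nonneg x)))

lemma traceLeft_joint : traceLeft s.joint = ∑ x, s.weighted x := by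
  rw [joint_eq_blockDiag, traceLeft]
  simp

lemma trace_traceLeft_joint : (traceLeft s.joint).trace = 1 := by
  simp only [traceLeft_joint, Matrix.trace_sum, weighted, Matrix.trace_smul, s.ρ_trace,
    smul_eq_mul, mul_one]
  exact_mod_cast s.p_sum

lemma trace_joint : s.joint.trace = 1 := by
  rw [joint_eq_blockDiag, trace_blockDiag, ← Matrix.trace_sum, ← traceLeft_joint,
    trace_traceLeft_joint]

lemma traceLeft_joint_nonneg : 0 ≤ traceLeft s.joint := by
  rw [traceLeft_joint]
  exact Finset.sum_nonneg fun x _ => s.weighted_nonneg x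

lemma joint_nonneg : 0 ≤ s.joint := by
  rw [joint_eq_blockDiag]
  exact blockDiag_nonneg s.weighted_nonneg

/-- Each block is one summand of `ρ_E`. This supplies the support inclusion behind the derivative at
order 1. -/
lemma joint_le : s.joint ≤ (1 : Matrix X X ℂ) ⊗ₖ traceLeft s.joint := by
  rw [one_kronecker_eq_blockDiag]
  conv_lhs => rw [joint_eq_blockDiag]
  refine sub_nonneg.mp ?_
  rw [blockDiag_sub]
  refine blockDiag_nonneg fun x => sub_nonneg.mpr ?_
  rw [traceLeft_joint]
  exact Finset.single_le_sum (f := s.weighted) (fun y _ => s.weighted_nonneg y) (Finset.mem_univ x)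

lemma quasiEntropy_eq_sum (β : ℝ) : s.quasiEntropy β =
    ∑ x, (cfc (fun t : ℝ => t ^ β) (s.weighted x) *
      cfc (fun t : ℝ => t ^ (1 - β)) (traceLeft s.joint)).trace.re := by
  rw [quasiEntropy, one_kronecker_eq_blockDiag,
    cfc_blockDiag _ fun _ => s.traceLeft_joint_nonneg.isSelfAdjoint]
  conv_lhs => rw [joint_eq_blockDiag, cfc_blockDiag _ fun x => (s.weighted_nonneg x).isSelfAdjoint,
    blockDiag_mul, trace_blockDiag, Complex.re_sum]
  rw [← joint_eq_blockDiag]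
  rfl

lemma quasiEntropy_nonneg (β : ℝ) : 0 ≤ s.quasiEntropy β :=
  trace_mul_nonneg (cfc_rpow_nonneg s.joint_nonneg _)
    (cfc_rpow_nonneg (s.joint_nonneg.trans s.joint_le) _)

lemma condRenyi_joint (β : ℝ) :
    condRenyi β s.joint = -(1 / (β - 1) * Real.log (s.quasiEntropy β)) := rfl

lemma block_tensorPow (n : ℕ) (x : Fin n → X) :
    block (tensorPow n s.joint) x = piTensor fun i => s.weighted (x i) := by
  ext e e'
  simp [block, tensorPow, piTensor_apply, joint_eq_blockDiag, blockDiag_apply]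

lemma block_tensorPow_nonneg (n : ℕ) (x : Fin n → X) : 0 ≤ block (tensorPow n s.joint) x := by
  rw [block_tensorPow]
  exact piTensor_nonneg fun i => s.weighted_nonneg _

lemma traceLeft_tensorPow (n : ℕ) :
    traceLeft (tensorPow n s.joint) = piTensor fun _ : Fin n => traceLeft s.joint := by
  rw [traceLeft, traceLeft_joint, ← piTensor_sum]
  exact Finset.sum_congr rfl fun x _ => s.block_tensorPow n x

lemma trace_traceLeft_tensorPow (n : ℕ) : (traceLeft (tensorPow n s.joint)).trace.re = 1 := by
  simp [traceLeft_tensorPow, trace_piTensor, trace_traceLeft_joint]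

/-- Multiplicativity of the quasi-entropy under tensor powers. -/
lemma sum_trace_tensorPow (n : ℕ) (β : ℝ) :
    ∑ x, (cfc (fun t : ℝ => t ^ β) (block (tensorPow n s.joint) x) *
      cfc (fun t : ℝ => t ^ (1 - β)) (traceLeft (tensorPow n s.joint))).trace.re =
      s.quasiEntropy β ^ n := by
  have h1 : ∀ x, ((cfc (fun t : ℝ => t ^ β) (s.weighted x) *
      cfc (fun t : ℝ => t ^ (1 - β)) (traceLeft s.joint)).trace.re : ℂ) =
      (cfc (fun t : ℝ => t ^ β) (s.weighted x) *
        cfc (fun t : ℝ => t ^ (1 - β)) (traceLeft s.joint)).trace := fun x =>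
    re_trace_mul_eq (cfc_rpow_nonneg (s.weighted_nonneg x) _)
      (cfc_rpow_nonneg s.traceLeft_joint_nonneg _)
  have h2 : ∀ x : Fin n → X, (cfc (fun t : ℝ => t ^ β) (block (tensorPow n s.joint) x) *
      cfc (fun t : ℝ => t ^ (1 - β)) (traceLeft (tensorPow n s.joint))).trace.re =
      ∏ i, (cfc (fun t : ℝ => t ^ β) (s.weighted (x i)) *
        cfc (fun t : ℝ => t ^ (1 - β)) (traceLeft s.joint)).trace.re := by
    intro x
    rw [block_tensorPow, traceLeft_tensorPow, cfc_rpow_piTensor fun i => s.weighted_nonneg _,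
      cfc_rpow_piTensor fun _ => s.traceLeft_joint_nonneg, piTensor_mul, trace_piTensor]
    simp only [Pi.mul_apply]
    rw [← Complex.ofReal_inj]
    push_cast
    simp only [h1]
    rw [Finset.prod_congr rfl fun i _ => (h1 (x i)).symm, ← Complex.ofReal_prod, Complex.ofReal_re]
  rw [Finset.sum_congr rfl fun x _ => h2 x, quasiEntropy_eq_sum, Finset.sum_pow',
    ← Fintype.piFinset_univ]

/-- Exponential strong converse, in terms of the quasi-entropy. -/
lemma one_sub_exp_le_expTraceDist {n : ℕ} (hn : 1 ≤ n) {Z : Type*} [Fintype Z] [DecidableEq Z]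
    [Nonempty Z] {q : PMF ((Fin n → X) → Z)} (hq : StronglyTwoUniversal q) {R : ℝ}
    (hR : R ≤ 1 / (n : ℝ) * Real.log (Fintype.card Z : ℝ)) {β : ℝ} (h0 : 0 < β) (h1 : β < 1) :
    1 - 4 * Real.exp (-((n : ℝ) * ((1 - β) * (R - condRenyi β s.joint)))) ≤
      expTraceDist q (tensorPow n s.joint) := by
  refine le_trans ?_ (one_sub_le_expTraceDist hq (s.block_tensorPow_nonneg n)
    (s.trace_traceLeft_tensorPow n) h0 h1)
  rw [sum_trace_tensorPow]
  have hn0 : (0 : ℝ) < n := by exact_mod_cast hn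
  have hM0 : (0 : ℝ) < Fintype.card Z := Nat.cast_pos.mpr Fintype.card_pos
  have hnR : n * R ≤ Real.log (Fintype.card Z : ℝ) := by
    have := mul_le_mul_of_nonneg_left hR hn0.le
    rwa [← mul_assoc, mul_one_div_cancel hn0.ne', one_mul] at this
  have e : -((n : ℝ) * ((1 - β) * (R - condRenyi β s.joint))) =
      -(1 - β) * (n * R) + n * Real.log (s.quasiEntropy β) := by
    rw [condRenyi_joint]
    have : β - 1 ≠ 0 := by linarith
    field_simp
    ring
  have h2 : (Fintype.card Z : ℝ)⁻¹ ^ (1 - β) ≤ Real.exp (-(1 - β) * (n * R)) := by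
    rw [Real.rpow_def_of_pos (inv_pos.mpr hM0), Real.log_inv]
    refine Real.exp_le_exp.mpr ?_
    nlinarith
  -- Valid also for a vanishing quasi-entropy, where `Real.log 0 = 0` makes the right side 1.
  have h3 : s.quasiEntropy β ^ n ≤ Real.exp (n * Real.log (s.quasiEntropy β)) := by
    rw [Real.exp_nat_mul]
    exact pow_le_pow_left₀ (s.quasiEntropy_nonneg β) (Real.le_exp_log _) n
  have h4 := mul_le_mul h2 h3 (pow_nonneg (s.quasiEntropy_nonneg β) n) (Real.exp_pos _).le
  rw [← Real.exp_add, ← e] at h4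
  linarith

end CQState

end State

/-! ### Relative entropy as a derivative at order 1. -/

section Derivative

/-- If `A ≤ B`, then the quasi-entropies of `A` relative to `B` are differentiable at `1`, with
derivative the relative entropy. -/
lemma hasDerivAt_trace_rpow {m : Type*} [Fintype m] [DecidableEq m] {A B : Matrix m m ℂ}
    (hA : 0 ≤ A) (hAB : A ≤ B) :
    HasDerivAt (fun β : ℝ => (cfc (fun t : ℝ => t ^ β) A *
        cfc (fun t : ℝ => t ^ (1 - β)) B).trace.re) (relEntropy A B) 1 ∧
      (cfc (fun t : ℝ => t ^ (1 : ℝ)) A * cfc (fun t : ℝ => t ^ (1 - 1 : ℝ)) B).trace.re =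
        A.trace.re := by
  have hB := hA.trans hAB
  have hcA := continuousOn_spectrum A
  have hcB := continuousOn_spectrum B
  -- Since `0 ^ 0 = 1`, the zeroth power of `B` is the full identity, not the support projection.
  have hone : cfc (fun t : ℝ => t ^ (1 : ℝ)) A * cfc (fun t : ℝ => t ^ (1 - 1 : ℝ)) B = A := by
    simp only [Real.rpow_one, sub_self, Real.rpow_zero]
    rw [cfc_id' ℝ A, cfc_const_one ℝ B, mul_one]
  refine ⟨?_, by rw [hone]⟩
  obtain ⟨a, b, w, ha, hb, hw, h⟩ := exists_trace_cfc_mul_cfc hA hB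
  -- Testing `A ≤ B` against the kernel projection `cfc g B` of `B`: nonnegative terms with sum at
  -- most 0 all vanish.
  have hsupp : ∀ i j, b j = 0 → a i * w i j = 0 := by
    set g : ℝ → ℝ := fun t => if t = 0 then 1 else 0 with hg
    have hg0 : ∀ t, 0 ≤ g t := fun t => by simp only [hg]; split_ifs <;> norm_num
    have h1 : (A * cfc g B).trace.re = ∑ i, ∑ j, a i * g (b j) * w i j := by
      rw [← h (fun t => t) g, cfc_id' ℝ A]
    have h2 : B * cfc g B = 0 := by
      conv_lhs =>
        enter [1]
        rw [← cfc_id' ℝ B]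
      rw [← cfc_mul _ _ B (hcB _) (hcB _), ← cfc_zero ℝ B]
      exact cfc_congr fun t _ => by simp [hg]
    have h3 : (A * cfc g B).trace.re ≤ 0 := by
      have := trace_mul_le_trace_mul (cfc_nonneg fun t _ => hg0 t : 0 ≤ cfc g B) hAB
      rwa [Matrix.trace_mul_comm, Matrix.trace_mul_comm _ B, h2, Matrix.trace_zero,
        Complex.zero_re] at this
    have hnn : ∀ i j, 0 ≤ a i * g (b j) * w i j := fun i j =>
      mul_nonneg (mul_nonneg (ha i) (hg0 _)) (hw i j)
    rw [h1] at h3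
    have h4 := (Finset.sum_eq_zero_iff_of_nonneg fun i _ => Finset.sum_nonneg fun j _ => hnn i j).mp
      (le_antisymm h3 (Finset.sum_nonneg fun i _ => Finset.sum_nonneg fun j _ => hnn i j))
    intro i j hj
    have h5 := (Finset.sum_eq_zero_iff_of_nonneg fun j _ => hnn i j).mp (h4 i (Finset.mem_univ i)) j
      (Finset.mem_univ j)
    simpa [hg, hj] using h5
  have hrel : relEntropy A B = ∑ i, ∑ j, a i * (Real.log (a i) - Real.log (b j)) * w i j := by
    have e1 : A * cfc Real.log A =
        cfc (fun t : ℝ => t * Real.log t) A * cfc (fun _ : ℝ => (1 : ℝ)) B := by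
      rw [cfc_const_one ℝ B, mul_one, cfc_mul _ _ A (hcA _) (hcA _), cfc_id' ℝ A]
    have e2 : A * cfc Real.log B = cfc (fun t : ℝ => t) A * cfc Real.log B := by
      rw [cfc_id' ℝ A]
    rw [relEntropy, mul_sub, Matrix.trace_sub, Complex.sub_re, e1, e2, h, h,
      ← Finset.sum_sub_distrib]
    refine Finset.sum_congr rfl fun i _ => ?_
    rw [← Finset.sum_sub_distrib]
    exact Finset.sum_congr rfl fun j _ => by ring
  simp only [h, hrel]
  refine HasDerivAt.fun_sum fun i _ => HasDerivAt.fun_sum fun j _ => ?_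
  rcases (hw i j).eq_or_lt with hw0 | hw0
  · simpa [← hw0] using hasDerivAt_const (1 : ℝ) (0 : ℝ)
  rcases (ha i).eq_or_lt with ha0 | ha0
  · rw [← ha0]
    simp only [zero_mul]
    refine (hasDerivAt_const (1 : ℝ) (0 : ℝ)).congr_of_eventuallyEq ?_
    filter_upwards [isOpen_ne.mem_nhds (one_ne_zero : (1 : ℝ) ≠ 0)] with β hβ
    simp [Real.zero_rpow hβ]
  have hb0 : 0 < b j := (hb j).lt_of_ne' fun hj =>
    (mul_pos ha0 hw0).ne' (hsupp i j hj)
  have d1 : HasDerivAt (fun β : ℝ => a i ^ β) (a i * Real.log (a i)) 1 := by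
    simpa [mul_comm] using (hasDerivAt_id (1 : ℝ)).const_rpow ha0
  have d2 : HasDerivAt (fun β : ℝ => b j ^ (1 - β)) (-Real.log (b j)) 1 := by
    simpa using ((hasDerivAt_id (1 : ℝ)).const_sub 1).const_rpow hb0
  have e : a i * (Real.log (a i) - Real.log (b j)) * w i j =
      (a i * Real.log (a i) * b j ^ (1 - 1 : ℝ) + a i ^ (1 : ℝ) * -Real.log (b j)) * w i j := by
    simp only [sub_self, Real.rpow_zero, Real.rpow_one]
    ring
  rw [e]
  exact (d1.fun_mul d2).mul_const (w i j)

end Derivative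

/-! ### The limit of order 1 and the conclusion. -/

namespace CQState

variable {X E : Type*} [Fintype X] [DecidableEq X] [Fintype E] [DecidableEq E]

/-- The conditional Rényi entropies approach the conditional entropy as the order tends to `1`. -/
lemma exists_condRenyi_lt (s : CQState X E) {R : ℝ} (hR : condEntropy s.joint < R) :
    ∃ β : ℝ, 0 < β ∧ β < 1 ∧ condRenyi β s.joint < R := by
  obtain ⟨hd, h1⟩ := hasDerivAt_trace_rpow s.joint_nonneg s.joint_le
  change HasDerivAt s.quasiEntropy _ 1 at hd
  change s.quasiEntropy 1 = _ at h1
  rw [s.trace_joint, Complex.one_re] at h1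
  have hlt : -R < relEntropy s.joint ((1 : Matrix X X ℂ) ⊗ₖ traceLeft s.joint) := by
    rw [condEntropy] at hR
    linarith
  have e1 := (hasDerivAt_iff_tendsto_slope.mp hd).eventually (lt_mem_nhds hlt)
  have e2 := hd.continuousAt.eventually (lt_mem_nhds (h1.symm ▸ zero_lt_one :
    (0 : ℝ) < s.quasiEntropy 1))
  have e3 : ∀ᶠ β in nhdsWithin (1 : ℝ) (Set.Iio 1), 0 < β :=
    nhdsWithin_le_nhds (lt_mem_nhds zero_lt_one)
  have e1' : ∀ᶠ β in nhdsWithin (1 : ℝ) (Set.Iio 1), -R < slope s.quasiEntropy 1 β :=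
    nhdsWithin_mono (1 : ℝ) (fun x (hx : x < 1) => (hx.ne : x ≠ 1)) e1
  have e2' : ∀ᶠ β in nhdsWithin (1 : ℝ) (Set.Iio 1), 0 < s.quasiEntropy β :=
    nhdsWithin_le_nhds e2
  obtain ⟨β, ⟨⟨hs, hp⟩, h0⟩, hβ⟩ := (((e1'.and e2').and e3).and self_mem_nhdsWithin).exists
  have hβ1 : β < 1 := hβ
  refine ⟨β, h0, hβ1, ?_⟩
  have hpos : 0 < 1 - β := by linarith
  rw [slope_def_field, h1] at hs
  -- By `log t ≤ t - 1`, the Rényi entropy is at most minus the slope of the quasi-entropy between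
  -- `β` and 1, which is below `R`.
  rw [condRenyi_joint, show -(1 / (β - 1) * Real.log (s.quasiEntropy β)) =
    Real.log (s.quasiEntropy β) / (1 - β) by rw [← neg_sub 1 β]; field_simp, div_lt_iff₀ hpos]
  rw [lt_div_iff_of_neg (by linarith)] at hs
  linarith [Real.log_le_sub_one_of_pos hp]

/-- A probability distribution forces `X` to be nonempty, and any function in the support of `q`
then takes a value in `Z`. -/
lemma nonempty_of_pmf (s : CQState X E) {n : ℕ} {Z : Type*} (q : PMF ((Fin n → X) → Z)) :
    Nonempty Z := by
  have hX : Nonempty X := by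
    by_contra h
    rw [not_nonempty_iff] at h
    simpa using s.p_sum
  obtain ⟨h, -⟩ := q.support_nonempty
  exact hX.map fun x => h fun _ => x

end CQState

end PrivacyAmplification

theorem corollary2 {X E : Type*} [Fintype X] [DecidableEq X] [Fintype E] [DecidableEq E]
    (s : PrivacyAmplification.CQState X E) :
    (∀ (n : ℕ), 1 ≤ n → ∀ (Z : Type*) [Fintype Z] [DecidableEq Z] (q : PMF ((Fin n → X) → Z)),
      PrivacyAmplification.StronglyTwoUniversal q →
      ∀ R : ℝ, R = 1 / (n : ℝ) * Real.log (Fintype.card Z : ℝ) →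
      ∀ α : ℝ, 1 / 2 < α → α < 1 →
        1 - 4 * Real.exp (-((n : ℝ) * ((1 - α) / α *
            (R - PrivacyAmplification.condRenyi (2 - 1 / α) s.joint))))
          ≤ PrivacyAmplification.expTraceDist q
              (PrivacyAmplification.tensorPow n s.joint)) ∧
    (∀ R : ℝ, PrivacyAmplification.condEntropy s.joint < R →
      ∃ c : ℝ, 0 < c ∧
        ∀ (n : ℕ), 1 ≤ n → ∀ (Z : Type*) [Fintype Z] [DecidableEq Z]
          (q : PMF ((Fin n → X) → Z)),
          PrivacyAmplification.StronglyTwoUniversal q →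
          R ≤ 1 / (n : ℝ) * Real.log (Fintype.card Z : ℝ) →
          1 - 4 * Real.exp (-(c * (n : ℝ))) ≤ PrivacyAmplification.expTraceDist q
              (PrivacyAmplification.tensorPow n s.joint) ∧
          PrivacyAmplification.expTraceDist q
              (PrivacyAmplification.tensorPow n s.joint) ≤ 1) := by
  refine ⟨fun n hn Z _ _ q hq R hR α h0 h1 => ?_, fun R hR => ?_⟩
  · have := s.nonempty_of_pmf q
    have hα : 0 < α := by linarith
    -- With `β = 2 - 1/α` the prefactor is `1 - β`, and `1/2 < α < 1` becomes `0 < β < 1`.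
    have e : (1 - α) / α = 1 - (2 - 1 / α) := by
      field_simp
      ring
    have h2 : 1 < 1 / α := (one_lt_div hα).mpr h1
    have h3 : 1 / α < 2 := (div_lt_iff₀ hα).mpr (by linarith)
    rw [e]
    exact s.one_sub_exp_le_expTraceDist hn hq hR.le (by linarith) (by linarith)
  · obtain ⟨β, h0, h1, hβ⟩ := s.exists_condRenyi_lt hR
    refine ⟨(1 - β) * (R - PrivacyAmplification.condRenyi β s.joint),
      mul_pos (by linarith) (by linarith), fun n hn Z _ _ q hq hRZ => ⟨?_, ?_⟩⟩
    · have := s.nonempty_of_pmf q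
      rw [mul_comm _ (n : ℝ)]
      exact s.one_sub_exp_le_expTraceDist hn hq hRZ h0 h1
    · have := s.nonempty_of_pmf q
      exact PrivacyAmplification.expTraceDist_le_one q (s.block_tensorPow_nonneg n)
        (s.trace_traceLeft_tensorPow n)
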